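/- Let $A(\rho)=A_0+\sum_{i=1}^{p}\rho_iA_i$ with $A_0,\dots,A_p\in\mathbb{R}^{n\times n}$ and $\rho\in\mathbb{R}^p$, and let $B\in\mathbb{R}^{n\times m}$. For $\rho\in\mathbb{R}^p$ let $$\mathcal{K}_\rho=\{K\in\mathbb{R}^{m\times n} : \operatorname{Re}\lambda<0 \text{ for every complex eigenvalue } \lambda \text{ of } A(\rho)-BK\}$$ be the stability region of $(A(\rho),B)$. Write $$\det\bigl(sI-(A(\rho)-BK)\bigr)=s^n+c_1s^{n-1}+\dots+c_{n-1}s+c_n,\qquad c_0=1,\quad c_k=0 \text{ for } k>n,$$ and define the division-free modified Routh table by $\tilde R_{1,j}=c_{2j-2}$, $\tilde R_{2,j}=c_{2j-1}$ and $$\tilde R_{i,j}=\tilde R_{i-1,1}\tilde R_{i-2,j+1}-\tilde R_{i-2,1}\tilde R_{i-1,j+1}\qquad (3\le i\le n,\ j\ge 1).$$ Put $f_i(K,\rho)=\tilde R_{i+1,1}$ for $1\le i<n$ (so that $f_1=c_1$) and $f_n(K,\rho)=c_n$. Then $f_1,\dots,f_n$ are polynomials with real coefficients in the entries of $K$ and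 $\rho$ (the same polynomials for all $K$ and $\rho$), and for every $\rho\in\mathbb{R}^p$, in particular for every $\rho$ in a given parameter set $\mathcal{P}\subset\mathbb{R}^p$, $$\mathcal{K}_\rho=\{K\in\mathbb{R}^{m\times n} : f_i(K,\rho)>0,\ i=1,\dots,n\}.$$ -/

import Mathlib

/-- The affine parameter-dependent system matrix `A(ρ) = A₀ + ∑ i, ρ i • A i`. -/
def lpvMatrix {n p : ℕ} (A₀ : Matrix (Fin n) (Fin n) ℝ) (A : Fin p → Matrix (Fin n) (Fin n) ℝ)
    (ρ : Fin p → ℝ) : Matrix (Fin n) (Fin n) ℝ :=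
  A₀ + ∑ i, ρ i • A i

/-- A real square matrix is Hurwitz if all its complex eigenvalues have negative real part. -/
def IsHurwitz {n : ℕ} (M : Matrix (Fin n) (Fin n) ℝ) : Prop :=
  ∀ z ∈ spectrum ℂ (M.map (fun x : ℝ => (x : ℂ))), z.re < 0

/-- The set of gains `K` for which `M - B K` is Hurwitz (for `M = A(ρ)`, the set `𝒦_ρ`). -/
def stabilityRegion {n m : ℕ} (M : Matrix (Fin n) (Fin n) ℝ) (B : Matrix (Fin n) (Fin m) ℝ) :
    Set (Matrix (Fin m) (Fin n) ℝ) :=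
  {K | IsHurwitz (M - B * K)}

/-- The coefficient `c_k` of `q(s) = c_0 s^n + c_1 s^(n-1) + ⋯ + c_n`; missing terms
(`k > n`) are zero. -/
def routhCoeff {R : Type*} [CommRing R] (n : ℕ) (q : Polynomial R) (k : ℕ) : R :=
  if k ≤ n then q.coeff (n - k) else 0

/-- The division-free modified Routh table. Rows and columns are counted from `0`: the entry in
row `i` and column `j` here is the entry with indices `i + 1`, `j + 1` in the usual 1-based
numbering. The first two rows are `c_0, c_2, c_4, …` and `c_1, c_3, c_5, …`. -/
def modRouth {R : Type*} [CommRing R] (c : ℕ → R) : ℕ → ℕ → R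
  | 0, j => c (2 * j)
  | 1, j => c (2 * j + 1)
  | i + 2, j =>
      modRouth c (i + 1) 0 * modRouth c i (j + 1) - modRouth c i 0 * modRouth c (i + 1) (j + 1)

/-- The `n` test quantities for a polynomial of degree `n`. For `1 ≤ i < n` the `i`-th one is the
first entry of the (1-based) row `i + 1` of the modified table (so it is `c_1` for `i = 1`), and
the `n`-th one is `c_n`. Here `i : Fin n` stands for the 1-based index `i + 1`. -/
def routhTest {R : Type*} [CommRing R] (n : ℕ) (q : Polynomial R) (i : Fin n) : R :=
  if (i : ℕ) + 1 = n then routhCoeff n q n else modRouth (routhCoeff n q) ((i : ℕ) + 1) 0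

/-- The value at `(K, ρ)` of a polynomial in the entries of `K` and of `ρ`. -/
noncomputable def evalGain {n m p : ℕ} (K : Matrix (Fin m) (Fin n) ℝ) (ρ : Fin p → ℝ)
    (f : MvPolynomial ((Fin m × Fin n) ⊕ Fin p) ℝ) : ℝ :=
  MvPolynomial.eval (Sum.elim (fun ij => K ij.1 ij.2) ρ) f

/-!
Write `f = E + O` for a real polynomial `f` of degree `n`, leading coefficient `a > 0` and next
coefficient `b`, where `E` collects the terms `c_k s^(n-k)` with `k` even and `O` those with `k`
odd. Passing from `f` to `O + b E - a s O`, of degree `n - 1`, deletes the first row of the Routh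
table, so by induction it suffices that `f` is stable iff its image is when `b > 0`; a stable `f` of
positive degree has `b > 0` because `-b / a` is the sum of its roots.

If `O + b E - a s O` is stable, its modulus at `-s` is at most that at `s` for `Re s ≥ 0`, and at a
zero `s` of `f` (where `E = -O`) this reads `|1 + w| |O| ≤ |1 - w| |O|` with `w = b + a s`, so
`O = 0`. Conversely, `f(-s) / f(s)` is up to sign a finite Blaschke product of the right half-plane
for stable `f`, and Julia's inequality at infinity for it, `a Re s |O|² ≤ b ⟪E, O⟫`, turns
`0 = ⟪O, O + b E - a s O⟫` into `|O|² ≤ 0`.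
-/

open Polynomial ComplexConjugate

section RouthTable

variable {R S : Type*} [CommRing R] [CommRing S]

theorem routhCoeff_succ_succ (n : ℕ) (q : R[X]) (k : ℕ) :
    routhCoeff (n + 1) q (k + 1) = routhCoeff n q k := by
  simp [routhCoeff]

theorem routhCoeff_X_mul (n : ℕ) (q : R[X]) (k : ℕ) :
    routhCoeff n (X * q) k = routhCoeff n q (k + 1) := by
  obtain hk | rfl | hk := lt_trichotomy k n
  · obtain ⟨l, rfl⟩ := Nat.exists_eq_add_of_lt hk
    rw [routhCoeff, routhCoeff, if_pos hk.le, if_pos (by omega),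
      show k + l + 1 - k = k + l + 1 - (k + 1) + 1 by omega, coeff_X_mul]
  · simp [routhCoeff]
  · rw [routhCoeff, routhCoeff, if_neg (by omega), if_neg (by omega)]

theorem routhCoeff_zero_eq_leadingCoeff (q : R[X]) :
    routhCoeff q.natDegree q 0 = q.leadingCoeff := by
  simp [routhCoeff]

theorem routhCoeff_one_eq_nextCoeff (q : R[X]) :
    routhCoeff q.natDegree q 1 = q.nextCoeff := by
  grind [routhCoeff, nextCoeff]

theorem routhTest_zero {f : R[X]} {e : ℕ} (hf : f.natDegree = e + 1) :
    routhTest (e + 1) f 0 = f.nextCoeff := by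
  rw [← routhCoeff_one_eq_nextCoeff, hf, routhTest]
  split_ifs with h
  · rw [← h]
    rfl
  · rfl

theorem modRouth_eq_modRouth_succ {c c' : ℕ → R} (h₁ : ∀ j, c' (2 * j) = modRouth c 1 j)
    (h₂ : ∀ j, c' (2 * j + 1) = modRouth c 2 j) (i j : ℕ) :
    modRouth c' i j = modRouth c (i + 1) j := by
  induction i using Nat.twoStepInduction generalizing j with
  | zero => exact h₁ j
  | one => exact h₂ j
  | more i ih₀ ih₁ => simp only [modRouth, ih₀, ih₁]

theorem map_routhCoeff (φ : R →+* S) (n : ℕ) (q : R[X]) (k : ℕ) :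
    φ (routhCoeff n q k) = routhCoeff n (q.map φ) k := by
  unfold routhCoeff
  split_ifs <;> simp

theorem map_modRouth (φ : R →+* S) (c : ℕ → R) (i j : ℕ) :
    φ (modRouth c i j) = modRouth (fun k => φ (c k)) i j := by
  induction i using Nat.twoStepInduction generalizing j with
  | zero => rfl
  | one => rfl
  | more i ih₀ ih₁ => simp only [modRouth, map_sub, map_mul, ih₀, ih₁]

theorem map_routhTest (φ : R →+* S) (n : ℕ) (q : R[X]) (i : Fin n) :
    φ (routhTest n q i) = routhTest n (q.map φ) i := by
  simp only [routhTest, apply_ite φ, map_modRouth, map_routhCoeff]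

end RouthTable

section RouthStep

theorem coeff_comp_neg_X {R : Type*} [CommRing R] (p : R[X]) (m : ℕ) :
    (p.comp (-X)).coeff m = (-1) ^ m * p.coeff m := by
  rw [show (-X : R[X]) = C (-1) * X by simp, comp_C_mul_X_coeff, mul_comm]

variable {F : Type*} [Field F]

/-- The part of `f` made of the terms `c_k s ^ (n - k)` with `k` even, where `n` is the degree of
`f`. It is obtained by averaging `f` with `(-1) ^ n f(-s)`. -/
noncomputable def routhEven (f : F[X]) : F[X] :=
  C (1 / 2) * (f + C ((-1) ^ f.natDegree) * f.comp (-X))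

/-- The part of `f` made of the terms `c_k s ^ (n - k)` with `k` odd, where `n` is the degree of
`f`. -/
noncomputable def routhOdd (f : F[X]) : F[X] :=
  C (1 / 2) * (f - C ((-1) ^ f.natDegree) * f.comp (-X))

/-- One step of the division-free Routh algorithm, which replaces `f` by a polynomial of degree one
less whose modified Routh table is that of `f` without its first row. -/
noncomputable def routhStep (f : F[X]) : F[X] :=
  routhOdd f + C f.nextCoeff * routhEven f - C f.leadingCoeff * (X * routhOdd f)

section CharZero

variable [CharZero F] (f : F[X])

theorem coeff_routhEven (m : ℕ) :
    (routhEven f).coeff m = if Even (f.natDegree + m) then f.coeff m else 0 := by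
  rw [routhEven, coeff_C_mul, coeff_add, coeff_C_mul, coeff_comp_neg_X, ← mul_assoc, ← pow_add]
  split_ifs with h
  · rw [h.neg_one_pow]
    ring
  · rw [(Nat.not_even_iff_odd.1 h).neg_one_pow]
    ring

theorem routhEven_add_routhOdd : routhEven f + routhOdd f = f := by
  rw [routhEven, routhOdd, ← mul_add, add_add_sub_cancel, ← two_mul, ← mul_assoc, ← C_ofNat,
    ← C_mul]
  norm_num

theorem coeff_routhOdd (m : ℕ) :
    (routhOdd f).coeff m = if Even (f.natDegree + m) then 0 else f.coeff m := by
  rw [eq_sub_of_add_eq' (routhEven_add_routhOdd f), coeff_sub, coeff_routhEven]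
  split_ifs <;> simp

theorem routhCoeff_routhEven (k : ℕ) :
    routhCoeff f.natDegree (routhEven f) k = if Even k then routhCoeff f.natDegree f k else 0 := by
  by_cases hk : k ≤ f.natDegree
  · have hparity : Even (f.natDegree + (f.natDegree - k)) ↔ Even k := by grind
    simp only [routhCoeff, coeff_routhEven, if_pos hk, hparity]
  · simp [routhCoeff, hk]

theorem routhCoeff_routhOdd (k : ℕ) :
    routhCoeff f.natDegree (routhOdd f) k = if Even k then 0 else routhCoeff f.natDegree f k := by
  by_cases hk : k ≤ f.natDegree
  · have hparity : Even (f.natDegree + (f.natDegree - k)) ↔ Even k := by grind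
    simp only [routhCoeff, coeff_routhOdd, if_pos hk, hparity]
  · simp [routhCoeff, hk]

theorem routhCoeff_routhStep (k : ℕ) :
    routhCoeff f.natDegree (routhStep f) k =
      if Even k then
        f.nextCoeff * routhCoeff f.natDegree f k - f.leadingCoeff * routhCoeff f.natDegree f (k + 1)
      else routhCoeff f.natDegree f k := by
  have hlinear : routhCoeff f.natDegree (routhStep f) k =
      routhCoeff f.natDegree (routhOdd f) k +
        f.nextCoeff * routhCoeff f.natDegree (routhEven f) k -
          f.leadingCoeff * routhCoeff f.natDegree (X * routhOdd f) k := by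
    unfold routhCoeff routhStep
    split_ifs <;> simp
  rw [hlinear, routhCoeff_X_mul, routhCoeff_routhOdd, routhCoeff_routhOdd, routhCoeff_routhEven]
  by_cases hk : Even k <;> simp [hk, Nat.even_add_one]

theorem natDegree_routhEven_le : (routhEven f).natDegree ≤ f.natDegree := by
  refine natDegree_le_iff_coeff_eq_zero.2 fun m hm => ?_
  rw [coeff_routhEven, coeff_eq_zero_of_natDegree_lt hm, ite_self]

theorem natDegree_routhOdd_le : (routhOdd f).natDegree ≤ f.natDegree - 1 := by
  refine natDegree_le_iff_coeff_eq_zero.2 fun m hm => ?_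
  obtain rfl | hm : m = f.natDegree ∨ f.natDegree < m := by omega
  · rw [coeff_routhOdd, if_pos (Even.add_self _)]
  · rw [coeff_routhOdd, coeff_eq_zero_of_natDegree_lt hm, ite_self]

variable {f}

theorem natDegree_routhStep_le {e : ℕ} (hf : f.natDegree = e + 1) :
    (routhStep f).natDegree ≤ e := by
  have hE := natDegree_routhEven_le f
  have hO := natDegree_routhOdd_le f
  have hbE := natDegree_C_mul_le f.nextCoeff (routhEven f)
  have haXO := natDegree_C_mul_le f.leadingCoeff (X * routhOdd f)
  have hXO := natDegree_mul_le (p := X) (q := routhOdd f)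
  rw [natDegree_X] at hXO
  have hle : (routhStep f).natDegree ≤ e + 1 :=
    (natDegree_sub_le _ _).trans
      (max_le ((natDegree_add_le _ _).trans (max_le (by omega) (by omega))) (by omega))
  have htop := routhCoeff_routhStep f 0
  rw [if_pos Even.zero, zero_add, routhCoeff_zero_eq_leadingCoeff, routhCoeff_one_eq_nextCoeff,
    mul_comm, sub_self, hf] at htop
  exact natDegree_le_pred hle htop

theorem coeff_routhStep {e : ℕ} (hf : f.natDegree = e + 1) :
    (routhStep f).coeff e = f.nextCoeff := by
  have h := routhCoeff_routhStep f 1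
  rw [if_neg Nat.not_even_one, routhCoeff_one_eq_nextCoeff, hf, routhCoeff_succ_succ] at h
  exact h

theorem natDegree_routhStep {e : ℕ} (hf : f.natDegree = e + 1) (hb : f.nextCoeff ≠ 0) :
    (routhStep f).natDegree = e :=
  natDegree_eq_of_le_of_coeff_ne_zero (natDegree_routhStep_le hf) (by rwa [coeff_routhStep hf])

theorem leadingCoeff_routhStep {e : ℕ} (hf : f.natDegree = e + 1) (hb : f.nextCoeff ≠ 0) :
    (routhStep f).leadingCoeff = f.nextCoeff := by
  rw [leadingCoeff, natDegree_routhStep hf hb, coeff_routhStep hf]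

theorem modRouth_routhStep {e : ℕ} (hf : f.natDegree = e + 1) (i j : ℕ) :
    modRouth (routhCoeff e (routhStep f)) i j = modRouth (routhCoeff f.natDegree f) (i + 1) j := by
  refine modRouth_eq_modRouth_succ (fun j => ?_) (fun j => ?_) i j <;>
    rw [← routhCoeff_succ_succ, ← hf, routhCoeff_routhStep]
  · simp [modRouth]
  · rw [if_pos (by grind), ← routhCoeff_zero_eq_leadingCoeff, ← routhCoeff_one_eq_nextCoeff]
    rfl

end CharZero

variable [LinearOrder F] [IsStrictOrderedRing F] {f : F[X]}

theorem routhCoeff_self_routhStep_pos_iff {e : ℕ} (hf : f.natDegree = e + 1)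
    (hb : 0 < f.nextCoeff) :
    0 < routhCoeff e (routhStep f) e ↔ 0 < routhCoeff (e + 1) f (e + 1) := by
  have hbeyond : routhCoeff (e + 1) f (e + 1 + 1) = 0 := if_neg (by omega)
  rw [← routhCoeff_succ_succ, ← hf, routhCoeff_routhStep, hf, hbeyond, mul_zero, sub_zero]
  split_ifs
  · exact mul_pos_iff_of_pos_left hb
  · rfl

theorem routhTest_routhStep_pos_iff {e : ℕ} (hf : f.natDegree = e + 1) (hb : 0 < f.nextCoeff)
    (i : Fin e) : 0 < routhTest e (routhStep f) i ↔ 0 < routhTest (e + 1) f i.succ := by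
  simp only [routhTest, Fin.val_succ, Nat.add_right_cancel_iff]
  split_ifs
  · exact routhCoeff_self_routhStep_pos_iff hf hb
  · rw [modRouth_routhStep hf, hf]

end RouthStep

section Julia

theorem mul_norm_add_sq_le {E : Type*} [SeminormedAddCommGroup E] {x S T A B : ℝ} {y z : E}
    (hx : 0 ≤ x) (hS : 0 ≤ S) (hT : 0 ≤ T) (hA : 0 ≤ A) (hB : 0 ≤ B)
    (hy : x * ‖y‖ ^ 2 ≤ S * A) (hz : x * ‖z‖ ^ 2 ≤ T * B) :
    x * ‖y + z‖ ^ 2 ≤ (S + T) * (A + B) := by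
  have hcross : 2 * (x * (‖y‖ * ‖z‖)) ≤ S * B + T * A := by
    refine le_of_sq_le_sq ?_ (by positivity)
    have hmul := mul_le_mul hy hz (by positivity) (by positivity)
    nlinarith [sq_nonneg (S * B - T * A)]
  calc x * ‖y + z‖ ^ 2 ≤ x * (‖y‖ + ‖z‖) ^ 2 := by gcongr; exact norm_add_le y z
    _ = x * ‖y‖ ^ 2 + x * ‖z‖ ^ 2 + 2 * (x * (‖y‖ * ‖z‖)) := by ring
    _ ≤ S * A + T * B + (S * B + T * A) := by gcongr
    _ = (S + T) * (A + B) := by ring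

section MultisetProd

variable {ι 𝕜 : Type*} [NormedField 𝕜] {u w : ι → 𝕜} {m : Multiset ι}

theorem norm_prod_map_le_norm_prod_map (h : ∀ i ∈ m, ‖w i‖ ≤ ‖u i‖) :
    ‖(m.map w).prod‖ ≤ ‖(m.map u).prod‖ := by
  have hnorm : ∀ v : ι → 𝕜, ‖(m.map v).prod‖ = (m.map fun i => ‖v i‖).prod := fun v =>
    (Multiset.prod_hom' m (normHom : 𝕜 →*₀ ℝ) v).symm
  rw [hnorm, hnorm]
  exact Multiset.prod_map_le_prod_map₀ _ _ (fun i _ => norm_nonneg _) h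

theorem mul_norm_prod_sub_prod_sq_le {x : ℝ} {σ : ι → ℝ} (hx : 0 ≤ x) (hσ : ∀ i ∈ m, 0 ≤ σ i)
    (hle : ∀ i ∈ m, ‖w i‖ ≤ ‖u i‖)
    (h : ∀ i ∈ m, x * ‖u i - w i‖ ^ 2 ≤ σ i * (‖u i‖ ^ 2 - ‖w i‖ ^ 2)) :
    x * ‖(m.map u).prod - (m.map w).prod‖ ^ 2 ≤
      (m.map σ).sum * (‖(m.map u).prod‖ ^ 2 - ‖(m.map w).prod‖ ^ 2) := by
  induction m using Multiset.induction_on with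
  | empty => simp
  | cons i m ih =>
    simp only [Multiset.forall_mem_cons] at hσ hle h
    simp only [Multiset.map_cons, Multiset.prod_cons, Multiset.sum_cons]
    have hsum : 0 ≤ (m.map σ).sum := Multiset.sum_nonneg (by simpa using hσ.2)
    have hprod := norm_prod_map_le_norm_prod_map hle.2
    have hprod' := ih hσ.2 hle.2 h.2
    set U := (m.map u).prod
    set W := (m.map w).prod
    have hsplit : u i * U - w i * W = (u i - w i) * W + u i * (U - W) := by ring
    have hnorm : ‖u i * U‖ ^ 2 - ‖w i * W‖ ^ 2 =
        ‖W‖ ^ 2 * (‖u i‖ ^ 2 - ‖w i‖ ^ 2) + ‖u i‖ ^ 2 * (‖U‖ ^ 2 - ‖W‖ ^ 2) := by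
      rw [norm_mul, norm_mul]
      ring
    rw [hsplit, hnorm]
    refine mul_norm_add_sq_le hx hσ.1 hsum ?_ ?_ ?_ ?_
    · exact mul_nonneg (sq_nonneg _) (sub_nonneg.2 (by gcongr; exact hle.1))
    · exact mul_nonneg (sq_nonneg _) (sub_nonneg.2 (by gcongr))
    · rw [norm_mul, mul_pow]
      linear_combination ‖W‖ ^ 2 * h.1
    · rw [norm_mul, mul_pow]
      linear_combination ‖u i‖ ^ 2 * hprod'

end MultisetProd

theorem norm_sub_sq_sub_norm_add_conj_sq (s r : ℂ) :
    ‖s - r‖ ^ 2 - ‖s + conj r‖ ^ 2 = -4 * r.re * s.re := by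
  simp only [Complex.sq_norm, Complex.normSq_apply, Complex.sub_re, Complex.sub_im, Complex.add_re,
    Complex.add_im, Complex.conj_re, Complex.conj_im]
  ring

theorem norm_add_conj_le_norm_sub {s r : ℂ} (hs : 0 ≤ s.re) (hr : r.re ≤ 0) :
    ‖s + conj r‖ ≤ ‖s - r‖ := by
  refine le_of_sq_le_sq (sub_nonneg.1 ?_) (norm_nonneg _)
  rw [norm_sub_sq_sub_norm_add_conj_sq]
  nlinarith

theorem norm_sub_sub_add_conj_sq (s r : ℂ) : ‖(s - r) - (s + conj r)‖ ^ 2 = 4 * r.re ^ 2 := by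
  rw [show (s - r) - (s + conj r) = -(r + conj r) by ring, Complex.add_conj, norm_neg,
    Complex.norm_real, Real.norm_eq_abs, sq_abs]
  ring

theorem re_mul_norm_prod_sub_prod_add_conj_sq_le {s : ℂ} (hs : 0 ≤ s.re) {m : Multiset ℂ}
    (hm : ∀ r ∈ m, r.re ≤ 0) :
    s.re * ‖(m.map fun r => s - r).prod - (m.map fun r => s + conj r).prod‖ ^ 2 ≤
      (m.map fun r => -r.re).sum *
        (‖(m.map fun r => s - r).prod‖ ^ 2 - ‖(m.map fun r => s + conj r).prod‖ ^ 2) := by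
  refine mul_norm_prod_sub_prod_sq_le hs (fun r hr => neg_nonneg.2 (hm r hr))
    (fun r hr => norm_add_conj_le_norm_sub hs (hm r hr)) fun r _ => ?_
  rw [norm_sub_sub_add_conj_sq, norm_sub_sq_sub_norm_add_conj_sq]
  exact le_of_eq (by ring)

end Julia

/-- A real polynomial is Hurwitz if all its complex zeros have negative real part. The zero
polynomial is not. -/
def IsHurwitzPolynomial (f : ℝ[X]) : Prop :=
  ∀ s : ℂ, aeval s f = 0 → s.re < 0

section Evaluation

variable (f : ℝ[X]) (s : ℂ)

theorem aeval_eq_leadingCoeff_mul_prod_aroots :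
    aeval s f = f.leadingCoeff * ((f.aroots ℂ).map fun r => s - r).prod :=
  (IsAlgClosed.splits _).aeval_eq_prod_aroots s

theorem neg_one_pow_natDegree_mul_aeval_neg :
    (-1) ^ f.natDegree * aeval (-s) f =
      f.leadingCoeff * ((f.aroots ℂ).map fun r => s + conj r).prod := by
  have hconj : aeval (-s) f = conj (aeval (-conj s) f) := by rw [← aeval_conj]; simp
  have hfactor : ∀ r : ℂ, conj (-conj s - r) = -(s + conj r) := fun r => by
    rw [map_sub, map_neg, Complex.conj_conj, neg_add, sub_eq_add_neg]
  have hprod : conj ((f.aroots ℂ).map fun r => -conj s - r).prod =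
      (-1) ^ f.natDegree * ((f.aroots ℂ).map fun r => s + conj r).prod := by
    rw [map_multiset_prod, Multiset.map_map, ← IsAlgClosed.card_aroots_eq_natDegree (B := ℂ),
      ← Multiset.card_map (fun r => s + conj r), ← Multiset.prod_map_neg, Multiset.map_map]
    simp only [Function.comp_def, hfactor]
  rw [hconj, aeval_eq_leadingCoeff_mul_prod_aroots, map_mul, Complex.conj_ofReal, hprod,
    mul_left_comm, ← mul_assoc ((-1) ^ _), ← mul_pow, neg_one_mul, neg_neg, one_pow, one_mul]

theorem nextCoeff_eq_leadingCoeff_mul_sum_aroots :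
    f.nextCoeff = f.leadingCoeff * ((f.aroots ℂ).map fun r => -r.re).sum := by
  have hvieta :=
    (IsAlgClosed.splits (f.map (algebraMap ℝ ℂ))).nextCoeff_eq_neg_sum_roots_mul_leadingCoeff
  rw [nextCoeff_map (algebraMap ℝ ℂ).injective, leadingCoeff_map, neg_mul,
    Complex.coe_algebraMap] at hvieta
  have hre : (f.aroots ℂ).sum.re = ((f.aroots ℂ).map Complex.re).sum :=
    map_multiset_sum Complex.reAddGroupHom _
  rw [← Complex.ofReal_re f.nextCoeff, hvieta, Complex.neg_re, Complex.re_ofReal_mul,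
    Multiset.sum_map_neg, mul_neg, hre]

theorem aeval_routhEven :
    aeval s (routhEven f) = (aeval s f + (-1) ^ f.natDegree * aeval (-s) f) / 2 := by
  simp only [routhEven, map_mul, map_add, aeval_comp, map_neg, aeval_X, aeval_C, map_div₀, map_pow,
    map_one, map_ofNat]
  ring

theorem aeval_routhOdd :
    aeval s (routhOdd f) = (aeval s f - (-1) ^ f.natDegree * aeval (-s) f) / 2 := by
  simp only [routhOdd, map_mul, map_sub, aeval_comp, map_neg, aeval_X, aeval_C, map_div₀, map_pow,
    map_one, map_ofNat]
  ring

theorem aeval_neg_routhEven :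
    aeval (-s) (routhEven f) = (-1) ^ f.natDegree * aeval s (routhEven f) := by
  have hsq : ((-1 : ℂ) ^ f.natDegree) ^ 2 = 1 := by rw [← pow_mul', pow_mul]; simp
  rw [aeval_routhEven, aeval_routhEven, neg_neg]
  linear_combination -(aeval (-s) f / 2) * hsq

theorem aeval_neg_routhOdd :
    aeval (-s) (routhOdd f) = -((-1) ^ f.natDegree * aeval s (routhOdd f)) := by
  have hsq : ((-1 : ℂ) ^ f.natDegree) ^ 2 = 1 := by rw [← pow_mul', pow_mul]; simp
  rw [aeval_routhOdd, aeval_routhOdd, neg_neg]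
  linear_combination -(aeval (-s) f / 2) * hsq

theorem aeval_routhStep :
    aeval s (routhStep f) = aeval s (routhOdd f) + f.nextCoeff * aeval s (routhEven f) -
      f.leadingCoeff * (s * aeval s (routhOdd f)) := by
  simp [routhStep]

theorem norm_aeval_sq_sub_norm_aeval_neg_sq :
    ‖aeval s f‖ ^ 2 - ‖aeval (-s) f‖ ^ 2 =
      4 * inner ℝ (aeval s (routhEven f)) (aeval s (routhOdd f)) := by
  have hadd : aeval s f = aeval s (routhEven f) + aeval s (routhOdd f) := by
    rw [← map_add, routhEven_add_routhOdd]
  have hsub : (-1) ^ f.natDegree * aeval (-s) f =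
      aeval s (routhEven f) - aeval s (routhOdd f) := by
    rw [aeval_routhEven, aeval_routhOdd]
    ring
  have hnorm : ‖aeval (-s) f‖ = ‖aeval s (routhEven f) - aeval s (routhOdd f)‖ := by
    rw [← hsub, norm_mul, norm_pow, norm_neg, norm_one, one_pow, one_mul]
  rw [hnorm, hadd, norm_add_sq_real, norm_sub_sq_real]
  ring

end Evaluation

namespace IsHurwitzPolynomial

variable {f : ℝ[X]}

theorem re_neg_of_mem_aroots (hf : IsHurwitzPolynomial f) {r : ℂ} (hr : r ∈ f.aroots ℂ) :
    r.re < 0 :=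
  hf r (mem_aroots.1 hr).2

theorem norm_aeval_neg_le (hf : IsHurwitzPolynomial f) {s : ℂ} (hs : 0 ≤ s.re) :
    ‖aeval (-s) f‖ ≤ ‖aeval s f‖ := by
  have hneg : ‖aeval (-s) f‖ = ‖(-1) ^ f.natDegree * aeval (-s) f‖ := by simp
  rw [hneg, neg_one_pow_natDegree_mul_aeval_neg, aeval_eq_leadingCoeff_mul_prod_aroots, norm_mul,
    norm_mul]
  gcongr
  exact norm_prod_map_le_norm_prod_map fun r hr =>
    norm_add_conj_le_norm_sub hs (hf.re_neg_of_mem_aroots hr).le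

theorem nextCoeff_pos (hf : IsHurwitzPolynomial f) (ha : 0 < f.leadingCoeff)
    (hdeg : f.natDegree ≠ 0) : 0 < f.nextCoeff := by
  rw [nextCoeff_eq_leadingCoeff_mul_sum_aroots]
  refine mul_pos ha ?_
  have hroots : f.aroots ℂ ≠ ∅ := fun h => hdeg <| by
    rw [← IsAlgClosed.card_aroots_eq_natDegree (B := ℂ), h, Multiset.empty_eq_zero,
      Multiset.card_zero]
  simpa using Multiset.sum_lt_sum_of_nonempty (f := fun _ => (0 : ℝ)) (g := fun r => -r.re) hroots
    fun r hr => neg_pos.2 (hf.re_neg_of_mem_aroots hr)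

theorem leadingCoeff_mul_re_mul_norm_routhOdd_sq_le (hf : IsHurwitzPolynomial f)
    (ha : 0 ≤ f.leadingCoeff) {s : ℂ} (hs : 0 ≤ s.re) :
    f.leadingCoeff * s.re * ‖aeval s (routhOdd f)‖ ^ 2 ≤
      f.nextCoeff * inner ℝ (aeval s (routhEven f)) (aeval s (routhOdd f)) := by
  have hprod := re_mul_norm_prod_sub_prod_add_conj_sq_le hs fun r hr =>
    (hf.re_neg_of_mem_aroots hr).le
  set a := f.leadingCoeff
  set σ := ((f.aroots ℂ).map fun r => -r.re).sum
  set U := ((f.aroots ℂ).map fun r => s - r).prod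
  set W := ((f.aroots ℂ).map fun r => s + conj r).prod
  have hU : aeval s f = a * U := aeval_eq_leadingCoeff_mul_prod_aroots f s
  have hW : (-1) ^ f.natDegree * aeval (-s) f = a * W := neg_one_pow_natDegree_mul_aeval_neg f s
  have hnorm : ‖aeval (-s) f‖ = ‖a * W‖ := by rw [← hW]; simp
  have hodd : ‖aeval s (routhOdd f)‖ ^ 2 = a ^ 2 * ‖U - W‖ ^ 2 / 4 := by
    rw [aeval_routhOdd, hU, hW, ← mul_sub, norm_div, norm_mul, Complex.norm_real, Real.norm_eq_abs,
      div_pow, mul_pow, sq_abs, Complex.norm_ofNat]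
    norm_num
  have hinner : inner ℝ (aeval s (routhEven f)) (aeval s (routhOdd f)) =
      a ^ 2 * (‖U‖ ^ 2 - ‖W‖ ^ 2) / 4 := by
    have h := norm_aeval_sq_sub_norm_aeval_neg_sq f s
    rw [hnorm, hU, norm_mul, norm_mul, Complex.norm_real, Real.norm_eq_abs, mul_pow, mul_pow,
      sq_abs] at h
    linarith
  calc a * s.re * ‖aeval s (routhOdd f)‖ ^ 2
      = a ^ 3 / 4 * (s.re * ‖U - W‖ ^ 2) := by rw [hodd]; ring
    _ ≤ a ^ 3 / 4 * (σ * (‖U‖ ^ 2 - ‖W‖ ^ 2)) := by gcongr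
    _ = f.nextCoeff * inner ℝ (aeval s (routhEven f)) (aeval s (routhOdd f)) := by
      rw [hinner, nextCoeff_eq_leadingCoeff_mul_sum_aroots]
      ring

theorem of_routhStep (hg : IsHurwitzPolynomial (routhStep f)) (ha : 0 ≤ f.leadingCoeff)
    (hb : 0 < f.nextCoeff) : IsHurwitzPolynomial f := by
  intro s hzero
  by_contra! hs
  have hE : aeval s (routhEven f) = -aeval s (routhOdd f) := by
    rw [eq_neg_iff_add_eq_zero, ← map_add, routhEven_add_routhOdd, hzero]
  set w : ℂ := f.nextCoeff + f.leadingCoeff * s with hw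
  have hat : aeval s (routhStep f) = (1 - w) * aeval s (routhOdd f) := by
    rw [aeval_routhStep, hE]
    ring
  have hat_neg : aeval (-s) (routhStep f) =
      -((-1) ^ f.natDegree * ((1 + w) * aeval s (routhOdd f))) := by
    rw [aeval_routhStep, aeval_neg_routhEven, aeval_neg_routhOdd, hE]
    ring
  have hwre : 0 < w.re := by
    simp only [hw, Complex.add_re, Complex.ofReal_re, Complex.re_ofReal_mul]
    positivity
  have hlt : ‖1 - w‖ < ‖1 + w‖ := by
    refine lt_of_pow_lt_pow_left₀ 2 (norm_nonneg _) ?_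
    simp only [Complex.sq_norm, Complex.normSq_apply, Complex.sub_re, Complex.sub_im,
      Complex.add_re, Complex.add_im, Complex.one_re, Complex.one_im]
    linarith
  have hO : aeval s (routhOdd f) = 0 := by
    have hle := hg.norm_aeval_neg_le hs
    rw [hat, hat_neg, norm_neg, norm_mul, norm_pow, norm_neg, norm_one, one_pow, one_mul, norm_mul,
      norm_mul] at hle
    by_contra hne
    exact (mul_lt_mul_of_pos_right hlt (norm_pos_iff.2 hne)).not_ge hle
  exact hs.not_gt (hg s (by rw [hat, hO, mul_zero]))

theorem routhStep (hf : IsHurwitzPolynomial f) (ha : 0 ≤ f.leadingCoeff)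
    (hb : f.nextCoeff ≠ 0) : IsHurwitzPolynomial (routhStep f) := by
  intro s hzero
  by_contra! hs
  have hJulia := hf.leadingCoeff_mul_re_mul_norm_routhOdd_sq_le ha hs
  rw [aeval_routhStep] at hzero
  set E := aeval s (routhEven f) with hE
  set O := aeval s (routhOdd f) with hO
  have hinner : ‖O‖ ^ 2 + (f.nextCoeff * inner ℝ E O - f.leadingCoeff * s.re * ‖O‖ ^ 2) = 0 := by
    have hXO : inner ℝ (s * O) O = s.re * ‖O‖ ^ 2 := by
      rw [Complex.inner, map_mul, mul_left_comm, Complex.mul_conj', ← Complex.ofReal_pow,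
        Complex.re_mul_ofReal, Complex.conj_re]
    have h := congrArg (fun z => inner ℝ z O) hzero
    simp only [← Complex.real_smul, inner_sub_left, inner_add_left, real_inner_smul_left,
      real_inner_self_eq_norm_sq, inner_zero_left] at h
    rw [hXO] at h
    linear_combination h
  have hO_zero : O = 0 := by
    by_contra hne
    have hpos : 0 < ‖O‖ ^ 2 := by positivity
    linarith
  have hE_zero : E = 0 := by simpa [hO_zero, hb] using hzero
  refine hs.not_gt (hf s ?_)
  rw [← routhEven_add_routhOdd f, map_add, ← hE, ← hO, hE_zero, hO_zero, add_zero]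

end IsHurwitzPolynomial

theorem isHurwitzPolynomial_of_natDegree_eq_zero {f : ℝ[X]} (hdeg : f.natDegree = 0) (hf : f ≠ 0) :
    IsHurwitzPolynomial f := by
  intro s hs
  rw [eq_C_of_natDegree_eq_zero hdeg, aeval_C, Complex.coe_algebraMap, Complex.ofReal_eq_zero] at hs
  exact absurd (by rw [eq_C_of_natDegree_eq_zero hdeg, hs, C_0]) hf

theorem isHurwitzPolynomial_iff_routhTest_pos {f : ℝ[X]} {n : ℕ} (hdeg : f.natDegree = n)
    (ha : 0 < f.leadingCoeff) : IsHurwitzPolynomial f ↔ ∀ i, 0 < routhTest n f i := by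
  induction n generalizing f with
  | zero =>
    have hf := isHurwitzPolynomial_of_natDegree_eq_zero hdeg (leadingCoeff_ne_zero.1 ha.ne')
    exact iff_of_true hf fun i => i.elim0
  | succ e ih =>
    have hstep (hb : 0 < f.nextCoeff) :
        IsHurwitzPolynomial f ↔ ∀ i, 0 < routhTest (e + 1) f (Fin.succ i) := by
      have hb' : 0 < (routhStep f).leadingCoeff := by rwa [leadingCoeff_routhStep hdeg hb.ne']
      calc IsHurwitzPolynomial f ↔ IsHurwitzPolynomial (routhStep f) :=
            ⟨fun hf => hf.routhStep ha.le hb.ne', fun hg => hg.of_routhStep ha.le hb⟩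
        _ ↔ ∀ i, 0 < routhTest e (routhStep f) i := ih (natDegree_routhStep hdeg hb.ne') hb'
        _ ↔ ∀ i, 0 < routhTest (e + 1) f (Fin.succ i) :=
            forall_congr' (routhTest_routhStep_pos_iff hdeg hb)
    rw [Fin.forall_fin_succ, routhTest_zero hdeg]
    constructor
    · intro hf
      have hb := hf.nextCoeff_pos ha (by omega)
      exact ⟨hb, (hstep hb).1 hf⟩
    · rintro ⟨hb, htest⟩
      exact (hstep hb).2 htest

section ClosedLoop

variable {n m p : ℕ}

theorem isHurwitz_iff_isHurwitzPolynomial_charpoly (M : Matrix (Fin n) (Fin n) ℝ) :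
    IsHurwitz M ↔ IsHurwitzPolynomial M.charpoly := by
  have hcharpoly : (M.map fun x : ℝ => (x : ℂ)).charpoly = M.charpoly.map (algebraMap ℝ ℂ) :=
    Matrix.charpoly_map M (algebraMap ℝ ℂ)
  simp only [IsHurwitz, IsHurwitzPolynomial, Matrix.mem_spectrum_iff_isRoot_charpoly, IsRoot.def,
    hcharpoly, eval_map_algebraMap]

theorem isHurwitz_iff_routhTest_charpoly_pos (M : Matrix (Fin n) (Fin n) ℝ) :
    IsHurwitz M ↔ ∀ i, 0 < routhTest n M.charpoly i := by
  rw [isHurwitz_iff_isHurwitzPolynomial_charpoly]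
  refine isHurwitzPolynomial_iff_routhTest_pos (by simp) ?_
  rw [M.charpoly_monic.leadingCoeff]
  exact one_pos

/-- The closed-loop matrix `A(ρ) - B K` over the polynomial ring in which the entries of `K`
(the variables `Sum.inl (k, j)`) and of `ρ` (the variables `Sum.inr i`) are indeterminates. -/
noncomputable def genericClosedLoop (A₀ : Matrix (Fin n) (Fin n) ℝ)
    (A : Fin p → Matrix (Fin n) (Fin n) ℝ) (B : Matrix (Fin n) (Fin m) ℝ) :
    Matrix (Fin n) (Fin n) (MvPolynomial ((Fin m × Fin n) ⊕ Fin p) ℝ) :=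
  Matrix.of fun a b =>
    MvPolynomial.C (A₀ a b) + ∑ i, MvPolynomial.X (Sum.inr i) * MvPolynomial.C (A i a b) -
      ∑ k, MvPolynomial.C (B a k) * MvPolynomial.X (Sum.inl (k, b))

theorem map_eval_genericClosedLoop (A₀ : Matrix (Fin n) (Fin n) ℝ)
    (A : Fin p → Matrix (Fin n) (Fin n) ℝ) (B : Matrix (Fin n) (Fin m) ℝ)
    (K : Matrix (Fin m) (Fin n) ℝ) (ρ : Fin p → ℝ) :
    (genericClosedLoop A₀ A B).map
        (MvPolynomial.eval (Sum.elim (fun ij : Fin m × Fin n => K ij.1 ij.2) ρ)) =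
      lpvMatrix A₀ A ρ - B * K := by
  ext a b
  simp [genericClosedLoop, lpvMatrix, Matrix.mul_apply, Matrix.sum_apply]

theorem evalGain_routhTest_charpoly_genericClosedLoop (A₀ : Matrix (Fin n) (Fin n) ℝ)
    (A : Fin p → Matrix (Fin n) (Fin n) ℝ) (B : Matrix (Fin n) (Fin m) ℝ)
    (K : Matrix (Fin m) (Fin n) ℝ) (ρ : Fin p → ℝ) (i : Fin n) :
    evalGain K ρ (routhTest n (genericClosedLoop A₀ A B).charpoly i) =
      routhTest n (lpvMatrix A₀ A ρ - B * K).charpoly i := by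
  rw [evalGain, map_routhTest, ← Matrix.charpoly_map, map_eval_genericClosedLoop]

end ClosedLoop

theorem mainTheorem10 {n m p : ℕ} (A₀ : Matrix (Fin n) (Fin n) ℝ)
    (A : Fin p → Matrix (Fin n) (Fin n) ℝ) (B : Matrix (Fin n) (Fin m) ℝ) :
    ∃ f : Fin n → MvPolynomial ((Fin m × Fin n) ⊕ Fin p) ℝ,
      (∀ (ρ : Fin p → ℝ) (K : Matrix (Fin m) (Fin n) ℝ) (i : Fin n),
        evalGain K ρ (f i) = routhTest n (lpvMatrix A₀ A ρ - B * K).charpoly i) ∧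
      ∀ ρ : Fin p → ℝ,
        stabilityRegion (lpvMatrix A₀ A ρ) B = {K | ∀ i : Fin n, 0 < evalGain K ρ (f i)} := by
  refine ⟨routhTest n (genericClosedLoop A₀ A B).charpoly,
    fun ρ K i => evalGain_routhTest_charpoly_genericClosedLoop A₀ A B K ρ i, fun ρ => ?_⟩
  ext K
  simp only [evalGain_routhTest_charpoly_genericClosedLoop]
  exact isHurwitz_iff_routhTest_charpoly_pos (lpvMatrix A₀ A ρ - B * K)
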